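/- Let $G$ be a Polish group that is Roelcke precompact, i.e. the Roelcke uniformity of $G$ (the finest uniformity coarser than both the left and the right uniformity of $G$) is totally bounded. Let $(X,d)$ be a complete separable metric space, and let $G\curvearrowright X$ be a transitive, continuous action by isometries. Then the action is uniformly micro-transitive: for every neighborhood $U$ of the identity in $G$ there is $\delta>0$ such that $B_\delta(x)\cap Gx\subseteq Ux$ for all $x\in X$, where $B_\delta(x)=\{y\in X: d(x,y)<\delta\}$. (As the action is transitive, $Gx=X$, so this says $B_\delta(x)\subseteq Ux$ for all $x\in X$.) -/

import Mathlib

open Topology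

/-- The Roelcke uniformity of a topological group: the finest uniformity that is coarser than
both the left and the right uniformity. In Mathlib's order on uniform structures, finer means
smaller, so this is the supremum `⊔`. A basis of entourages is given by the sets
`{(x, y) | y ∈ U x U}` for `U` a neighborhood of the identity. -/
abbrev roelckeUniformSpace (G : Type*) [Group G] [TopologicalSpace G] [IsTopologicalGroup G] :
    UniformSpace G :=
  IsTopologicalGroup.leftUniformSpace G ⊔ IsTopologicalGroup.rightUniformSpace G

/-- A topological group is Roelcke precompact if its Roelcke uniformity is totally bounded. -/
def IsRoelckePrecompact (G : Type*) [Group G] [TopologicalSpace G] [IsTopologicalGroup G] :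
    Prop :=
  @TotallyBounded G (roelckeUniformSpace G) Set.univ

/-- An action of a topological group `G` on a metric space `X` is uniformly micro-transitive if
for every neighborhood `U` of the identity there is `δ > 0` such that
`B_δ(x) ∩ G x ⊆ U x` for all `x`. -/
def IsUniformlyMicroTransitive (G X : Type*) [Group G] [TopologicalSpace G] [MetricSpace X]
    [MulAction G X] : Prop :=
  ∀ U ∈ 𝓝 (1 : G), ∃ δ : ℝ, 0 < δ ∧
    ∀ x : X, Metric.ball x δ ∩ MulAction.orbit G x ⊆ (fun g : G => g • x) '' U

open Set Filter
open scoped Pointwise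

/-! If uniformity fails, there are bad points `γ n • x₀` at scales tending to 0. An ultrafilter
finer than the tail filter of `γ` is Roelcke Cauchy. Being Cauchy controls group elements only up to
factors on both sides: the right factor barely moves `x₀`, and the left one is absorbed into a
corrector `h n` near 1, so `h n • g n • x₀` converges to some `y`, with each `g n` a late value of
`γ`. Effros' theorem at the single point `y` gives a ball inside `T y`; the isometry `h n` carries
it back to a bad point, a contradiction. Effros' theorem itself is Baire category followed by a
back-and-forth approximation. -/

/-- Dependent choice for an invariant and a transition relation that both depend on the step. -/
theorem exists_seq_of_invariant {T : Type*} (Q : ℕ → T → Prop) (R : ℕ → T → T → Prop) {s₀ : T}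
    (h₀ : Q 0 s₀) (hs : ∀ n s, Q n s → ∃ s', Q (n + 1) s' ∧ R n s s') :
    ∃ s : ℕ → T, s 0 = s₀ ∧ (∀ n, Q n (s n)) ∧ ∀ n, R n (s n) (s (n + 1)) := by
  choose! f hQ hR using hs
  let s : ℕ → T := fun n => Nat.rec s₀ f n
  have hs : ∀ n, Q n (s n) := fun n => by
    induction n with
    | zero => exact h₀
    | succ n ih => exact hQ n _ ih
  exact ⟨s, rfl, hs, fun n => hR n _ (hs n)⟩

/-- For a transitive action of a second countable group on a Baire space, the closure of `V x` is a
neighborhood of `x` whenever `V` is a neighborhood of the identity. -/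
theorem closure_image_smul_mem_nhds {G X : Type*} [Group G] [TopologicalSpace G]
    [IsTopologicalGroup G] [SecondCountableTopology G] [TopologicalSpace X] [BaireSpace X]
    [MulAction G X] [ContinuousConstSMul G X] [MulAction.IsPretransitive G X]
    {V : Set G} (hV : V ∈ 𝓝 (1 : G)) (x : X) :
    closure ((fun g : G => g • x) '' V) ∈ 𝓝 x := by
  obtain ⟨W, hW, -, hWinv, hWV⟩ := exists_closed_nhds_one_inv_eq_mul_subset hV
  obtain ⟨s, hs, hcov⟩ := TopologicalSpace.countable_cover_nhds
    (f := fun g : G => g • W) (fun g => by simpa using smul_mem_nhds_smul g hW)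
  obtain ⟨g, hi⟩ : ∃ g : s,
      (interior (closure ((g : G) • ((fun g : G => g • x) '' W)))).Nonempty := by
    have : Nonempty X := ⟨x⟩
    have := hs.to_subtype
    refine nonempty_interior_of_iUnion_of_closed (fun _ => isClosed_closure) ?_
    refine eq_univ_iff_forall.2 fun y => ?_
    obtain ⟨h, rfl⟩ := MulAction.exists_smul_eq G x y
    obtain ⟨g, hg, hh⟩ : ∃ g ∈ s, h ∈ g • W := by
      simpa only [mem_iUnion, exists_prop] using hcov.symm.subset (mem_univ h)
    obtain ⟨w, hw, rfl⟩ := hh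
    refine mem_iUnion.2 ⟨⟨g, hg⟩, subset_closure ?_⟩
    exact ⟨w • x, ⟨w, hw, rfl⟩, by simp [mul_smul]⟩
  -- The interior of the closure of `W x` meets `W x` at some `w • x`; translating by `w⁻¹`
  -- recentres it at `x`.
  rw [closure_smul, interior_smul, smul_set_nonempty] at hi
  obtain ⟨y, hy, w, hw, rfl⟩ := mem_closure_iff.1 (interior_subset hi.some_mem) _ isOpen_interior
    hi.some_mem
  have hwx : w⁻¹ • closure ((fun g : G => g • x) '' W) ∈ 𝓝 x := by
    have := smul_mem_nhds_smul w⁻¹ (mem_interior_iff_mem_nhds.1 hy)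
    simpa using this
  refine mem_of_superset hwx ?_
  rw [← closure_smul]
  refine closure_mono ?_
  rintro _ ⟨_, ⟨v, hv, rfl⟩, rfl⟩
  refine ⟨w⁻¹ * v, hWV (mul_mem_mul ?_ hv), by simp [mul_smul]⟩
  rw [← hWinv]
  simpa using hw

/-- Effros' theorem: a continuous transitive action of a Polish group on a metrizable Baire space is
micro-transitive. -/
theorem image_smul_mem_nhds_of_polishSpace {G X : Type*} [Group G] [TopologicalSpace G]
    [IsTopologicalGroup G] [PolishSpace G] [MetricSpace X] [BaireSpace X]
    [MulAction G X] [ContinuousSMul G X] [MulAction.IsPretransitive G X]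
    {U : Set G} (hU : U ∈ 𝓝 (1 : G)) (x : X) : (fun g : G => g • x) '' U ∈ 𝓝 x := by
  let := TopologicalSpace.upgradeIsCompletelyMetrizable G
  obtain ⟨S, hS, -, hSinv, hSU⟩ := exists_closed_nhds_one_inv_eq_mul_subset hU
  obtain ⟨C, hC, hCS⟩ := Metric.nhds_basis_closedBall.mem_iff.1 hS
  -- The complete metric need not be invariant, so the neighborhood must depend on the element `c`
  -- being multiplied.
  have key : ∀ (c : G) (n : ℕ), {v : G | dist c (v * c) ≤ C / 2 / 2 ^ n} ∈ 𝓝 (1 : G) := by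
    intro c n
    have : Tendsto (fun v : G => dist c (v * c)) (𝓝 1) (𝓝 0) := by
      have : Continuous fun v : G => dist c (v * c) := by fun_prop
      simpa using this.tendsto 1
    exact this.eventually_le_const (by positivity)
  refine mem_of_superset (closure_image_smul_mem_nhds (key 1 0) x) fun y hy => ?_
  let z : ℕ → X := fun n => if Even n then x else y
  have z_add_two : ∀ n, z (n + 2) = z n := fun n => by simp [z, Nat.even_add]
  -- A state is `(c n, c (n + 1), V)`. The next term is `c (n + 2) = v * c n` with `v ∈ V`, so even
  -- terms move `x`, odd terms move `y`, and the two orbits approach each other.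
  obtain ⟨s, hs₀, -, hs⟩ := exists_seq_of_invariant (T := G × G × Set G)
    (fun n s => s.2.2 ∈ 𝓝 (1 : G) ∧ (∀ v ∈ s.2.2, dist s.1 (v * s.1) ≤ C / 2 / 2 ^ n) ∧
      s.2.1 • z (n + 1) ∈ closure ((fun g : G => g • s.1 • z n) '' s.2.2))
    (fun n s s' => s'.1 = s.2.1 ∧ dist s.1 s'.2.1 ≤ C / 2 / 2 ^ n ∧
      dist (s.2.1 • z (n + 1)) (s'.2.1 • z n) < (1 / 2) ^ n)
    (s₀ := (1, 1, {v : G | dist 1 (v * 1) ≤ C / 2 / 2 ^ 0}))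
    ⟨key 1 0, fun v hv => hv, by simpa [z] using hy⟩ (by
      rintro n ⟨b, a, V⟩ ⟨-, hV, hab⟩
      obtain ⟨_, ⟨hq, hqd⟩, v, hv, rfl⟩ := mem_closure_iff_nhds.1 hab _
        (inter_mem (closure_image_smul_mem_nhds (key a (n + 1)) (a • z (n + 1)))
          (Metric.ball_mem_nhds _ (show (0 : ℝ) < (1 / 2) ^ n by positivity)))
      refine ⟨(a, v * b, {v : G | dist a (v * a) ≤ C / 2 / 2 ^ (n + 1)}),
        ⟨key a (n + 1), fun w hw => hw, ?_⟩, rfl, hV v hv, ?_⟩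
      · simpa [z_add_two, mul_smul] using hq
      · simpa [mul_smul, dist_comm] using hqd)
  let c : ℕ → G := fun n => (s n).1
  have hc : ∀ n, (s n).2.1 = c (n + 1) := fun n => (hs n).1.symm
  have hdist : ∀ n, dist (c n) (c (n + 2)) ≤ C / 2 / 2 ^ n := fun n => by
    simpa [hc] using (hs n).2.1
  have hnear : ∀ n, dist (c (n + 1) • z (n + 1)) (c (n + 2) • z n) < (1 / 2) ^ n := fun n => by
    simpa [hc] using (hs n).2.2
  have hc₀ : c 0 = 1 := by simp [c, hs₀]
  have hc₁ : c 1 = 1 := by rw [← hc, hs₀]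
  have lim : ∀ i, c i = 1 → ∃ g ∈ S, Tendsto (fun k => c (2 * k + i)) atTop (𝓝 g) := by
    intro i hi
    have hd : ∀ k, dist (c (2 * k + i)) (c (2 * (k + 1) + i)) ≤ C / 2 / 2 ^ k := fun k => by
      refine (show 2 * (k + 1) + i = 2 * k + i + 2 by ring) ▸ (hdist (2 * k + i)).trans ?_
      gcongr
      · norm_num
      · lia
    obtain ⟨g, hg⟩ := cauchySeq_tendsto_of_complete (cauchySeq_of_le_geometric_two hd)
    refine ⟨g, hCS ?_, hg⟩
    have := dist_le_of_le_geometric_two_of_tendsto₀ hd hg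
    rw [Metric.mem_closedBall, dist_comm]
    simpa [hi] using this
  obtain ⟨g, hgS, hg⟩ := lim 0 hc₀
  obtain ⟨h, hhS, hh⟩ := lim 1 hc₁
  have hgh : h • y = g • x := by
    have hlim := (hh.smul_const y).dist ((hg.comp (tendsto_add_atTop_nat 1)).smul_const x)
    have hpow : Tendsto (fun k : ℕ => (1 / 2 : ℝ) ^ (2 * k)) atTop (𝓝 0) :=
      (tendsto_pow_atTop_nhds_zero_of_lt_one (by norm_num) (by norm_num)).comp
        (tendsto_id.const_mul_atTop' two_pos)
    refine dist_le_zero.1 (le_of_tendsto_of_tendsto' hlim hpow fun k => ?_)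
    have hz₀ : z (2 * k) = x := by simp [z]
    have hz₁ : z (2 * k + 1) = y := by simp [z]
    simpa [hz₀, hz₁, mul_add] using (hnear (2 * k)).le
  refine ⟨h⁻¹ * g, hSU (mul_mem_mul ?_ hgS), ?_⟩
  · rw [← hSinv]
    simpa using hhS
  · simp [mul_smul, ← hgh]

/-- The sets `{(g, g') | g' ∈ V g V}` are entourages of the Roelcke uniformity. -/
theorem setOf_exists_mul_mul_mem_uniformity_roelcke {G : Type*} [Group G] [TopologicalSpace G]
    [IsTopologicalGroup G] {V : Set G} (hV : V ∈ 𝓝 (1 : G)) :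
    {p : G × G | ∃ v ∈ V, ∃ w ∈ V, p.2 = v * p.1 * w} ∈
      (roelckeUniformSpace G).uniformity := by
  let E : Set G → Set (G × G) := fun V => {p | ∃ v ∈ V, ∃ w ∈ V, p.2 = v * p.1 * w}
  have hE : Monotone E := by
    rintro V W h p ⟨v, hv, w, hw, hp⟩
    exact ⟨v, h hv, w, h hw, hp⟩
  have hmem : ∀ s, s ∈ (𝓝 (1 : G)).lift' E ↔ ∃ V ∈ 𝓝 (1 : G), E V ⊆ s := fun s =>
    mem_lift'_sets hE
  let u : UniformSpace G := UniformSpace.ofCore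
    { uniformity := (𝓝 (1 : G)).lift' E
      refl := by
        intro s hs
        obtain ⟨V, hV, hs⟩ := (hmem s).1 hs
        rintro ⟨g, _⟩ rfl
        exact hs ⟨1, mem_of_mem_nhds hV, 1, mem_of_mem_nhds hV, by simp⟩
      symm := by
        intro s hs
        obtain ⟨V, hV, hs⟩ := (hmem s).1 hs
        refine (hmem _).2 ⟨V⁻¹, inv_mem_nhds_one G hV, ?_⟩
        rintro ⟨g, h⟩ ⟨v, hv, w, hw, hgh⟩
        have hgh : h = v * g * w := hgh
        exact hs ⟨v⁻¹, hv, w⁻¹, hw, by simp [hgh, mul_assoc]⟩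
      comp := by
        intro s hs
        obtain ⟨V, hV, hs⟩ := (hmem s).1 hs
        obtain ⟨W, hW, -, -, hWV⟩ := exists_closed_nhds_one_inv_eq_mul_subset hV
        refine (mem_lift'_sets fun a b hab => SetRel.comp_subset_comp hab hab).2
          ⟨E W, (hmem _).2 ⟨W, hW, Subset.rfl⟩, ?_⟩
        rintro ⟨g, k⟩ ⟨h, ⟨v, hv, w, hw, hgh⟩, ⟨v', hv', w', hw', hhk⟩⟩
        have hgh : h = v * g * w := hgh
        have hhk : k = v' * h * w' := hhk
        exact hs ⟨v' * v, hWV (mul_mem_mul hv' hv), w * w', hWV (mul_mem_mul hw hw'),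
          by simp [hgh, hhk, mul_assoc]⟩ }
  have hu : roelckeUniformSpace G ≤ u := by
    refine sup_le ?_ ?_
    · intro s hs
      obtain ⟨V, hV, hs⟩ := (hmem s).1 hs
      refine ⟨V, hV, ?_⟩
      rintro ⟨g, h⟩ hgh
      exact hs ⟨1, mem_of_mem_nhds hV, _, hgh, by simp⟩
    · intro s hs
      obtain ⟨V, hV, hs⟩ := (hmem s).1 hs
      refine ⟨V, hV, ?_⟩
      rintro ⟨g, h⟩ hgh
      exact hs ⟨_, hgh, 1, mem_of_mem_nhds hV, by simp⟩
  exact hu ((hmem _).2 ⟨V, hV, Subset.rfl⟩)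

/-- If `f` is a Roelcke Cauchy filter and `B` is a sequence of members of `f`, then, after
moving points by elements of a fixed neighborhood `V` of the identity, the points `g • x₀` with
`g ∈ B n` accumulate somewhere. -/
theorem exists_tendsto_smul_of_cauchy_roelcke {G X : Type*} [Group G] [TopologicalSpace G]
    [IsTopologicalGroup G] [MetricSpace X] [CompleteSpace X] [MulAction G X] [ContinuousSMul G X]
    [IsIsometricSMul G X] {f : Filter G} (hf : @Cauchy G (roelckeUniformSpace G) f)
    {B : ℕ → Set G} (hB : ∀ n, B n ∈ f) {V : Set G} (hV : V ∈ 𝓝 (1 : G)) (x₀ : X) :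
    ∃ (g h : ℕ → G) (y : X), (∀ n, g n ∈ B n) ∧ (∀ n, h n ∈ V) ∧
      Tendsto (fun n => h n • g n • x₀) atTop (𝓝 y) := by
  have hsmall : ∀ n : ℕ, {w : G | dist x₀ (w • x₀) ≤ 1 / 2 / 2 ^ n} ∈ 𝓝 (1 : G) := by
    intro n
    have : Tendsto (fun w : G => dist x₀ (w • x₀)) (𝓝 1) (𝓝 0) := by
      have : Continuous fun w : G => dist x₀ (w • x₀) := by fun_prop
      simpa using this.tendsto 1
    exact this.eventually_le_const (by positivity)
  obtain ⟨W, hW₀, hW, hWW⟩ := exists_seq_of_invariant (T := Set G)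
    (fun _ W => W ∈ 𝓝 (1 : G)) (fun n W W' => W' * W' ⊆ W ∧
      ∀ w ∈ W', dist x₀ (w • x₀) ≤ 1 / 2 / 2 ^ n) hV (by
      intro n W hW
      obtain ⟨W', hW', -, -, h⟩ :=
        exists_closed_nhds_one_inv_eq_mul_subset (inter_mem hW (hsmall n))
      refine ⟨W', hW', h.trans inter_subset_left, fun w hw => (h ?_).2⟩
      simpa using mul_mem_mul hw (mem_of_mem_nhds hW'))
  have ht : ∀ n, ∃ t ∈ f, ∀ g ∈ t, ∀ g' ∈ t,
      ∃ v ∈ W (n + 1), ∃ w ∈ W (n + 1), g' = v * g * w := by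
    intro n
    obtain ⟨t, ht, hsub⟩ := mem_prod_same_iff.1
      (hf.2 (setOf_exists_mul_mul_mem_uniformity_roelcke (hW (n + 1))))
    exact ⟨t, ht, fun g hg g' hg' => hsub (mk_mem_prod hg hg')⟩
  choose t ht hsub using ht
  have := hf.1
  -- Intersecting over all `j ≤ n` puts both `g n` and `g (n + 1)` in `t n`.
  have hne : ∀ n, (B n ∩ ⋂ j ∈ Iic n, t j).Nonempty := fun n => nonempty_of_mem
    (inter_mem (hB n) ((biInter_mem (finite_Iic n)).2 fun j _ => ht j))
  choose g hgB hgt using hne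
  have hgt : ∀ n j, j ≤ n → g n ∈ t j := fun n j hj => mem_iInter₂.1 (hgt n) j hj
  choose v hv w hw hg using fun n => hsub n _ (hgt (n + 1) n n.le_succ) _ (hgt n n le_rfl)
  let h : ℕ → G := fun n => Nat.rec 1 (fun n k => k * v n) n
  -- The spare factor `u` makes the induction close, via `W (n + 1) * W (n + 1) ⊆ W n`.
  have hh : ∀ n, ∀ u ∈ W n, h n * u ∈ V := by
    intro n
    induction n with
    | zero => intro u hu; simpa [h, ← hW₀] using hu
    | succ n ih =>
      intro u hu
      rw [show h (n + 1) = h n * v n from rfl, mul_assoc]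
      exact ih _ ((hWW n).1 (mul_mem_mul (hv n) hu))
  have hd : ∀ n, dist (h n • g n • x₀) (h (n + 1) • g (n + 1) • x₀) ≤ 1 / 2 / 2 ^ n := by
    intro n
    rw [show h (n + 1) = h n * v n from rfl, hg n]
    simp only [mul_smul, dist_smul]
    rw [dist_comm]
    exact (hWW n).2 _ (hw n)
  obtain ⟨y, hy⟩ := cauchySeq_tendsto_of_complete (cauchySeq_of_le_geometric_two hd)
  exact ⟨g, h, y, hgB, fun n => by simpa using hh n 1 (mem_of_mem_nhds (hW n)), hy⟩

theorem theorem5p8 (G : Type*) [Group G] [TopologicalSpace G] [IsTopologicalGroup G]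
    [PolishSpace G] (hG : IsRoelckePrecompact G)
    (X : Type*) [MetricSpace X] [CompleteSpace X] [TopologicalSpace.SeparableSpace X]
    [MulAction G X] [ContinuousSMul G X] [IsIsometricSMul G X] [MulAction.IsPretransitive G X] :
    IsUniformlyMicroTransitive G X := by
  intro U hU
  rcases isEmpty_or_nonempty X with hX | ⟨⟨x₀⟩⟩
  · exact ⟨1, one_pos, fun x => isEmptyElim x⟩
  suffices H : ∃ δ : ℝ, 0 < δ ∧ ∀ x : X, Metric.ball x δ ⊆ (fun g : G => g • x) '' U by
    obtain ⟨δ, hδ, h⟩ := H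
    exact ⟨δ, hδ, fun x => inter_subset_left.trans (h x)⟩
  obtain ⟨S, hS, -, hSinv, hSU⟩ := exists_closed_nhds_one_inv_eq_mul_subset hU
  obtain ⟨T, hT, -, hTinv, hTS⟩ := exists_closed_nhds_one_inv_eq_mul_subset hS
  by_contra! H
  have hbad : ∀ n : ℕ, ∃ g : G, ¬ Metric.ball (g • x₀) (1 / (n + 1) : ℝ) ⊆
      (fun k : G => k • g • x₀) '' U := by
    intro n
    obtain ⟨x, hx⟩ := H (1 / (n + 1)) (by positivity)
    obtain ⟨g, rfl⟩ := MulAction.exists_smul_eq G x₀ x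
    exact ⟨g, hx⟩
  choose γ hγ using hbad
  let f : Ultrafilter G := Ultrafilter.of (map γ atTop)
  have hf : @Cauchy G (roelckeUniformSpace G) f :=
    (@totallyBounded_iff_ultrafilter G (roelckeUniformSpace G) _).1 hG f (by simp)
  have hB : ∀ n, γ '' Ici n ∈ (f : Filter G) := fun n =>
    Ultrafilter.of_le _ (image_mem_map (Ici_mem_atTop n))
  obtain ⟨g, h, y, hg, hh, hlim⟩ := exists_tendsto_smul_of_cauchy_roelcke hf hB hT x₀
  obtain ⟨r, hr, hball⟩ := Metric.mem_nhds_iff.1 (image_smul_mem_nhds_of_polishSpace hT y)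
  obtain ⟨n, hn, hny⟩ := ((tendsto_one_div_add_atTop_nhds_zero_nat.eventually_lt_const
    (half_pos hr)).and (hlim.eventually (Metric.ball_mem_nhds y (half_pos hr)))).exists
  obtain ⟨m, hm, hgm⟩ := hg n
  refine hγ m fun z hz => ?_
  rw [hgm] at hz ⊢
  have hmn : (1 / (m + 1) : ℝ) ≤ 1 / (n + 1) := Nat.one_div_le_one_div hm
  have hz' : h n • z ∈ Metric.ball y r := by
    have h₁ : dist (h n • z) (h n • g n • x₀) < r / 2 := by
      rw [dist_smul]
      exact (Metric.mem_ball.1 hz).trans_le (hmn.trans hn.le)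
    have h₂ : dist (h n • g n • x₀) y < r / 2 := hny
    exact Metric.mem_ball.2 (by linarith [dist_triangle (h n • z) (h n • g n • x₀) y])
  obtain ⟨s, hs, hsz⟩ := hball hz'
  obtain ⟨t, ht, hty⟩ := hball (Metric.ball_subset_ball (half_le_self hr.le) hny)
  have inv_mem : ∀ {k}, k ∈ T → k⁻¹ ∈ T := fun {k} hk => by
    rw [← hTinv]
    simpa using hk
  -- Both `h n • z` and `h n • g n • x₀` lie in `T y`; passing through `y` costs four factors from
  -- `T`.
  refine ⟨(h n)⁻¹ * s * (t⁻¹ * h n), hSU (mul_mem_mul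
    (hTS (mul_mem_mul (inv_mem (hh n)) hs)) (hTS (mul_mem_mul (inv_mem ht) (hh n)))), ?_⟩
  have e₁ : y = t⁻¹ • h n • g n • x₀ := by rw [eq_inv_smul_iff]; exact hty
  have e₂ : z = (h n)⁻¹ • s • y := by rw [eq_inv_smul_iff]; exact hsz.symm
  simp only [mul_smul]
  rw [e₂, e₁]
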